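/- A quadratic Lie superalgebra is a complex $\mathbb Z_2$-graded vector space $\mathfrak g=\mathfrak g_{\bar 0}\oplus\mathfrak g_{\bar 1}$ with a Lie superalgebra bracket $[\cdot,\cdot]$ and a bilinear form $B$ that is non-degenerate, even ($B(\mathfrak g_{\bar 0},\mathfrak g_{\bar 1})=B(\mathfrak g_{\bar 1},\mathfrak g_{\bar 0})=0$), supersymmetric (symmetric on $\mathfrak g_{\bar 0}$, skew-symmetric on $\mathfrak g_{\bar 1}$) and invariant ($B([X,Y],Z)=B(X,[Y,Z])$ for all $X,Y,Z\in\mathfrak g$). An isomorphism of Lie superalgebras is a degree-preserving linear isomorphism $A$ with $A([X,Y])=[A(X),A(Y)]'$ for all $X,Y$. Two quadratic Lie superalgebras $(\mathfrak g,B)$ and $(\mathfrak g',B')$ are isometrically isomorphic if there is an isomorphism of Lie superalgebras $A:\mathfrak g\to\mathfrak g'$ with $B'(A(X),A(Y))=B(X,Y)$ for all $X,Y\in\mathfrak g$. Let $n\ge 0$ and let $\mathscr S(2+2n)$ be the set of quadratic Lie superalgebra structures $([\cdot,\cdot],B)$ on the $\mathbb Z_2$-graded vector space $\mathbb C^2\oplus\mathbb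 C^{2n}$ with even part $\mathbb C^2$ and odd part $\mathbb C^{2n}$. Proposition. Let $\mathfrak g$ and $\mathfrak g'$ be elements of $\mathscr S(2+2n)$. Then $\mathfrak g$ and $\mathfrak g'$ are isometrically isomorphic if and only if they are isomorphic as Lie superalgebras. -/

import Mathlib

/-- A (complex) Lie superalgebra structure on a vector space `V` that is `ℤ/2`-graded by
`𝒱 0` (the even part) and `𝒱 1` (the odd part). -/
structure LieSuperalgebra {V : Type*} [AddCommGroup V] [Module ℂ V]
    (𝒱 : ZMod 2 → Submodule ℂ V) where
  /-- `V` is the direct sum of its even and odd parts. -/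
  isInternal : DirectSum.IsInternal 𝒱
  /-- The super-bracket, a bilinear map. -/
  bracket : V →ₗ[ℂ] V →ₗ[ℂ] V
  bracket_mem : ∀ (i j : ZMod 2), ∀ x ∈ 𝒱 i, ∀ y ∈ 𝒱 j, bracket x y ∈ 𝒱 (i + j)
  /-- Super-antisymmetry: `[x, y] = -(-1)^{|x||y|} [y, x]`. -/
  bracket_skew : ∀ (i j : ZMod 2), ∀ x ∈ 𝒱 i, ∀ y ∈ 𝒱 j,
    bracket x y = -((-1 : ℂ) ^ (i.val * j.val) • bracket y x)
  /-- Super Jacobi identity: `[x, [y, z]] = [[x, y], z] + (-1)^{|x||y|} [y, [x, z]]`. -/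
  jacobi : ∀ (i j k : ZMod 2), ∀ x ∈ 𝒱 i, ∀ y ∈ 𝒱 j, ∀ z ∈ 𝒱 k,
    bracket x (bracket y z) =
      bracket (bracket x y) z + (-1 : ℂ) ^ (i.val * j.val) • bracket y (bracket x z)

/-- A quadratic Lie superalgebra: a Lie superalgebra with a non-degenerate, even,
supersymmetric, invariant bilinear form. -/
structure QuadraticLieSuperalgebra {V : Type*} [AddCommGroup V] [Module ℂ V]
    (𝒱 : ZMod 2 → Submodule ℂ V) extends LieSuperalgebra 𝒱 where
  form : LinearMap.BilinForm ℂ V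
  form_nondegenerate : form.Nondegenerate
  form_even : ∀ (i j : ZMod 2), i ≠ j → ∀ x ∈ 𝒱 i, ∀ y ∈ 𝒱 j, form x y = 0
  form_supersymm : ∀ (i j : ZMod 2), ∀ x ∈ 𝒱 i, ∀ y ∈ 𝒱 j,
    form x y = (-1 : ℂ) ^ (i.val * j.val) * form y x
  form_invariant : ∀ x y z : V, form (bracket x y) z = form x (bracket y z)

/-- An isomorphism of Lie superalgebras: an even (i.e. degree-preserving) linear isomorphism
that respects the brackets. -/
structure LieSuperalgebra.Iso {V W : Type*} [AddCommGroup V] [Module ℂ V]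
    [AddCommGroup W] [Module ℂ W] {𝒱 : ZMod 2 → Submodule ℂ V} {𝒲 : ZMod 2 → Submodule ℂ W}
    (g : LieSuperalgebra 𝒱) (g' : LieSuperalgebra 𝒲) extends V ≃ₗ[ℂ] W where
  map_mem : ∀ (i : ZMod 2), ∀ x ∈ 𝒱 i, toLinearEquiv x ∈ 𝒲 i
  map_bracket : ∀ x y : V,
    toLinearEquiv (g.bracket x y) = g'.bracket (toLinearEquiv x) (toLinearEquiv y)

/-- `g` and `g'` are isomorphic as Lie superalgebras (the bilinear forms play no role). -/
def QuadraticLieSuperalgebra.IsIsomorphic {V W : Type*} [AddCommGroup V] [Module ℂ V]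
    [AddCommGroup W] [Module ℂ W] {𝒱 : ZMod 2 → Submodule ℂ V} {𝒲 : ZMod 2 → Submodule ℂ W}
    (g : QuadraticLieSuperalgebra 𝒱) (g' : QuadraticLieSuperalgebra 𝒲) : Prop :=
  Nonempty (LieSuperalgebra.Iso g.toLieSuperalgebra g'.toLieSuperalgebra)

/-- `g` and `g'` are isometrically isomorphic: there is an isomorphism of Lie superalgebras
that carries the bilinear form of `g` to that of `g'`. -/
def QuadraticLieSuperalgebra.IsIsometricallyIsomorphic {V W : Type*}
    [AddCommGroup V] [Module ℂ V] [AddCommGroup W] [Module ℂ W]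
    {𝒱 : ZMod 2 → Submodule ℂ V} {𝒲 : ZMod 2 → Submodule ℂ W}
    (g : QuadraticLieSuperalgebra 𝒱) (g' : QuadraticLieSuperalgebra 𝒲) : Prop :=
  ∃ A : LieSuperalgebra.Iso g.toLieSuperalgebra g'.toLieSuperalgebra,
    ∀ x y : V, g'.form (A.toLinearEquiv x) (A.toLinearEquiv y) = g.form x y

/-- The `ℤ/2`-grading of `ℂ² ⊕ ℂ²ⁿ` with even part `ℂ²` and odd part `ℂ²ⁿ`. -/
def stdGrading (n : ℕ) : ZMod 2 → Submodule ℂ ((Fin 2 → ℂ) × (Fin (2 * n) → ℂ)) := fun i =>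
  if i = 0 then LinearMap.range (LinearMap.inl ℂ (Fin 2 → ℂ) (Fin (2 * n) → ℂ))
  else LinearMap.range (LinearMap.inr ℂ (Fin 2 → ℂ) (Fin (2 * n) → ℂ))

/-- The set `𝒮(2+2n)` of quadratic Lie superalgebra structures on the `ℤ/2`-graded vector
space `ℂ² ⊕ ℂ²ⁿ`. The bilinear form is part of the structure, so two elements may carry
different forms. -/
abbrev QuadraticStructures (n : ℕ) := QuadraticLieSuperalgebra (stdGrading n)

/-! Pulling the second form back along an isomorphism leaves two invariant forms, with even and odd
parts `β₀, β₁` and `γ₀, γ₁`, on one superalgebra; an automorphism must carry one to the other.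

Write `γ₁ = β₁(M ·, ·)`. By `exists_sqrt`, `M = S²` with `S` a polynomial in `M`, so `S` is
self-adjoint and `S⁻¹` is an odd isometry. The even part is abelian. If odd brackets vanish, so does
the action, and square roots on both parts suffice.

Otherwise all odd brackets lie on an isotropic line `ℂX` (`bracket_mem_span`). Choose `Y` with
`β₀(X, Y) = 1`. Then `X` acts by zero, and `C = ρ Y` determines everything: `q x y = β₁(C x, y) X`.
Invariance of both forms gives `MC = CM = μC` with `μ = γ₀(X, Y)`, so `S⁻¹` commutes with `C` and
extends to the even part by `X ↦ μ⁻¹X`, `Y ↦ Y + bX`. -/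

/-! ### Square roots of operators and change of form -/

open Polynomial in
/-- `X` is a square modulo every complex polynomial that does not vanish at `0`. -/
theorem Polynomial.exists_dvd_sq_sub_X (m : ℂ[X]) (hm : m.eval 0 ≠ 0) :
    ∃ p : ℂ[X], m ∣ p ^ 2 - X := by
  suffices H : ∀ s : Multiset ℂ, (0 : ℂ) ∉ s →
      ∃ p : ℂ[X], (s.map fun a => X - C a).prod ∣ p ^ 2 - X by
    have hm0 : m ≠ 0 := by rintro rfl; simp at hm
    obtain ⟨p, hp⟩ := H m.roots (fun h => hm ((mem_roots hm0).1 h))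
    refine ⟨p, ?_⟩
    rw [(IsAlgClosed.splits m).eq_prod_roots]
    exact (isUnit_C.2 (leadingCoeff_ne_zero.2 hm0).isUnit).mul_left_dvd.2 hp
  intro s
  induction s using Multiset.induction with
  | empty => intro _; exact ⟨0, by simp⟩
  | cons l s ih =>
    intro hs
    rw [Multiset.mem_cons, not_or] at hs
    obtain ⟨p, q, hq⟩ := ih hs.2
    set m' := (s.map fun a => X - C a).prod
    -- Correcting `p` to `p + t m'` turns the cofactor `q` into `m' t² + 2 p t + q`, which must
    -- vanish at `l`. If `m'(l) = 0` this is linear in `t`, with `p(l)² = l ≠ 0`.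
    obtain ⟨t, ht⟩ : ∃ t : ℂ, m'.eval l * t ^ 2 + 2 * p.eval l * t + q.eval l = 0 := by
      by_cases h : m'.eval l = 0
      · have h2 : p.eval l ^ 2 = l := by
          have := congrArg (eval l) hq
          simp [h] at this
          linear_combination this
        have h3 : p.eval l ≠ 0 := by
          intro h0
          rw [h0] at h2
          exact hs.1 (by simpa using h2)
        refine ⟨-q.eval l / (2 * p.eval l), ?_⟩
        rw [h]
        field_simp
        ring
      · obtain ⟨r, hr⟩ := IsAlgClosed.exists_pow_nat_eq
          (discrim (m'.eval l) (2 * p.eval l) (q.eval l)) (n := 2) (by norm_num)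
        obtain ⟨t, ht⟩ := exists_quadratic_eq_zero h ⟨r, by rw [← hr, sq]⟩
        exact ⟨t, by rw [← ht]; ring⟩
    obtain ⟨u, hu⟩ : X - C l ∣ m' * C t ^ 2 + 2 * p * C t + q := by
      rw [dvd_iff_isRoot]
      simpa using ht
    refine ⟨p + m' * C t, u, ?_⟩
    rw [Multiset.map_cons, Multiset.prod_cons]
    linear_combination hq + m' * hu

/-- An invertible complex endomorphism has a square root that is a polynomial in it. -/
theorem LinearMap.exists_aeval_sq_eq {V : Type*} [AddCommGroup V] [Module ℂ V]
    [FiniteDimensional ℂ V] (M : Module.End ℂ V) (hM : Function.Injective M) :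
    ∃ p : Polynomial ℂ, Polynomial.aeval M p * Polynomial.aeval M p = M := by
  obtain ⟨p, q, hq⟩ := (minpoly ℂ M).exists_dvd_sq_sub_X (by
    intro h
    have h1 : Module.End.HasEigenvalue M 0 := Module.End.hasEigenvalue_of_isRoot h
    obtain ⟨v, hv⟩ := h1.exists_hasEigenvector
    exact hv.2 (hM (by simpa using hv.apply_eq_smul)))
  refine ⟨p, ?_⟩
  have := congrArg (Polynomial.aeval M) hq
  simp only [map_sub, map_pow, Polynomial.aeval_X, map_mul, minpoly.aeval, zero_mul] at this
  rw [← sq]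
  exact sub_eq_zero.1 this

/-- For two nondegenerate complex bilinear forms of the same parity, one is obtained from the other
through the square of a self-adjoint automorphism commuting with everything that commutes with
the change of form. -/
theorem LinearMap.BilinForm.exists_sqrt {V : Type*} [AddCommGroup V] [Module ℂ V]
    [FiniteDimensional ℂ V] (β γ : LinearMap.BilinForm ℂ V)
    (hβ : ∀ x, (∀ y, β x y = 0) → x = 0) (hγ : ∀ x, (∀ y, γ x y = 0) → x = 0)
    (ε : ℂ) (hε : ε * ε = 1) (sβ : ∀ x y, β x y = ε * β y x) (sγ : ∀ x y, γ x y = ε * γ y x) :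
    ∃ S : V ≃ₗ[ℂ] V, (∀ x y, γ x y = β (S (S x)) y) ∧ (∀ x y, β (S x) y = β x (S y)) ∧
      ∀ C : Module.End ℂ V, (∀ x, C (S (S x)) = S (S (C x))) → ∀ x, C (S x) = S (C x) := by
  have hβi : Function.Injective β := (injective_iff_map_eq_zero β).2 fun x hx =>
    hβ x fun y => by rw [hx]; rfl
  let e : V ≃ₗ[ℂ] Module.Dual ℂ V := LinearEquiv.ofInjectiveOfFinrankEq β hβi
    Subspace.dual_finrank_eq.symm
  let M : Module.End ℂ V := e.symm.toLinearMap ∘ₗ γ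
  have hM : ∀ x y, γ x y = β (M x) y := fun x y => by
    have : e (e.symm (γ x)) = γ x := e.apply_symm_apply _
    exact (LinearMap.congr_fun this y).symm
  have hMi : Function.Injective M := (injective_iff_map_eq_zero M).2 fun x hx =>
    hγ x fun y => by rw [hM, hx]; simp
  obtain ⟨p, hp⟩ := LinearMap.exists_aeval_sq_eq M hMi
  have hMadj : ∀ x y, β (M x) y = β x (M y) := fun x y => by
    rw [← hM, sγ, hM, sβ, ← mul_assoc, hε, one_mul]
  have hadj : ∀ (p : Polynomial ℂ) x y,
      β (Polynomial.aeval M p x) y = β x (Polynomial.aeval M p y) := by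
    intro p
    induction p using Polynomial.induction_on' with
    | add p q hp hq => intro x y; simp [hp, hq]
    | monomial k a =>
      intro x y
      have : ∀ (k : ℕ) x y, β ((M ^ k) x) y = β x ((M ^ k) y) := by
        intro k
        induction k with
        | zero => simp
        | succ k ih =>
          intro x y
          rw [pow_succ, Module.End.mul_apply, ih, hMadj, ← Module.End.mul_apply, ← pow_succ',
            pow_succ]
      simp [Polynomial.aeval_monomial, this]
  have hpx : ∀ x, Polynomial.aeval M p (Polynomial.aeval M p x) = M x := fun x =>
    LinearMap.congr_fun hp x
  have hSi : Function.Injective (Polynomial.aeval M p) := fun x y h => hMi (by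
    rw [← hpx, h, hpx])
  refine ⟨LinearEquiv.ofInjectiveEndo (Polynomial.aeval M p) hSi, fun x y => ?_, fun x y => ?_,
    fun C hC x => ?_⟩
  · simp [hpx, hM]
  · simpa using hadj p x y
  · simp only [LinearEquiv.coe_ofInjectiveEndo, hpx] at hC ⊢
    have h1 : Commute C M := LinearMap.ext hC
    have h2 : Commute C (Polynomial.aeval M p) :=
      Algebra.commute_of_mem_adjoin_of_forall_mem_commute
        (Polynomial.aeval_mem_adjoin_singleton ℂ M) (by simpa using h1)
    exact LinearMap.congr_fun h2 x

/-- Otherwise `x, v` would be a basis orthogonal to `x`, against nondegeneracy. -/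
theorem LinearMap.BilinForm.mem_span_of_isotropic {E : Type*} [AddCommGroup E] [Module ℂ E]
    (hE : Module.finrank ℂ E = 2) (β : LinearMap.BilinForm ℂ E)
    (hβ : ∀ x, (∀ y, β x y = 0) → x = 0) {x v : E}
    (hx : x ≠ 0) (hxx : β x x = 0) (hxv : β x v = 0) : ∃ c : ℂ, v = c • x := by
  have : FiniteDimensional ℂ E := Module.finite_of_finrank_eq_succ hE
  by_contra! h
  have hli : LinearIndependent ℂ ![x, v] := by
    rw [LinearIndependent.pair_iff' hx]
    exact fun a ha => h a ha.symm
  have hsp := hli.span_eq_top_of_card_eq_finrank (by simp [hE])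
  refine hx (hβ x fun y => ?_)
  have hy : y ∈ Submodule.span ℂ (Set.range ![x, v]) := hsp ▸ Submodule.mem_top
  rw [Matrix.range_cons, Matrix.range_cons, Matrix.range_empty, Set.union_empty,
    Set.singleton_union, Submodule.mem_span_pair] at hy
  obtain ⟨a, b, rfl⟩ := hy
  simp [hxx, hxv]

/-! ### Two invariant forms on the same brackets -/

section

variable {E O : Type*} [AddCommGroup E] [Module ℂ E] [AddCommGroup O] [Module ℂ O]

/-- The forms `β₀`, `β₁` on the even and odd parts are nondegenerate, supersymmetric and invariant
under the action `ρ` of the even part and the symmetric odd bracket `q`. -/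
structure IsInvariantPair (ρ : E →ₗ[ℂ] O →ₗ[ℂ] O) (q : O →ₗ[ℂ] O →ₗ[ℂ] E)
    (β₀ : LinearMap.BilinForm ℂ E) (β₁ : LinearMap.BilinForm ℂ O) : Prop where
  nondeg_even : ∀ x, (∀ y, β₀ x y = 0) → x = 0
  nondeg_odd : ∀ x, (∀ y, β₁ x y = 0) → x = 0
  symm_even : ∀ x y, β₀ x y = β₀ y x
  skew_odd : ∀ x y, β₁ x y = -β₁ y x
  invariant : ∀ e x y, β₁ (ρ e x) y = β₀ e (q x y)

variable {ρ : E →ₗ[ℂ] O →ₗ[ℂ] O} {q : O →ₗ[ℂ] O →ₗ[ℂ] E}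
  {β₀ γ₀ : LinearMap.BilinForm ℂ E} {β₁ γ₁ : LinearMap.BilinForm ℂ O}

theorem IsInvariantPair.form_bracket_self_bracket (hβ : IsInvariantPair ρ q β₀ β₁)
    (hJ : ∀ x, ρ (q x x) x = 0) (x y : O) : β₀ (q x x) (q x y) = 0 := by
  rw [← hβ.invariant, hJ, map_zero, LinearMap.zero_apply]

/-- Squares `q y y` are shown orthogonal to the isotropic vector `q x₀ x₀`, hence proportional to
it; polarization handles `q x y`. -/
theorem IsInvariantPair.bracket_mem_span (hβ : IsInvariantPair ρ q β₀ β₁)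
    (hE : Module.finrank ℂ E = 2) (hq : ∀ x y, q x y = q y x) (hJ : ∀ x, ρ (q x x) x = 0)
    {x₀ : O} (hx₀ : q x₀ x₀ ≠ 0) (x y : O) : ∃ c : ℂ, q x y = c • q x₀ x₀ := by
  have hI := hβ.form_bracket_self_bracket hJ
  have hself : ∀ y, ∃ c : ℂ, q y y = c • q x₀ x₀ := by
    intro y
    refine β₀.mem_span_of_isotropic hE hβ.nondeg_even hx₀ (hI _ _) ?_
    obtain ⟨c, hc⟩ := β₀.mem_span_of_isotropic hE hβ.nondeg_even hx₀ (hI _ _) (hI x₀ y)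
    -- In this expansion every term but `β₀ (q x₀ x₀) (q y y)` vanishes.
    have h1 := hI (x₀ + y) y
    have h2 := hI y x₀
    have h3 : β₀ (q x₀ y) (q y y) = 0 := by rw [hβ.symm_even, hq x₀ y]; exact h2
    have h4 : β₀ (q x₀ y) (q x₀ y) = 0 := by rw [hc]; simp [hI]
    rw [hq y x₀] at h2
    simp only [map_add, LinearMap.add_apply, hq y x₀, h2, h3, h4, hI] at h1
    simpa using h1
  obtain ⟨a, ha⟩ := hself (x + y)
  obtain ⟨b, hb⟩ := hself x
  obtain ⟨c, hc⟩ := hself y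
  refine ⟨(a - b - c) / 2, ?_⟩
  simp only [map_add, LinearMap.add_apply, hq y x] at ha
  rw [hb, hc] at ha
  have h2 : (2 : ℂ) • q x y = (a - b - c) • q x₀ x₀ := by
    rw [sub_smul, sub_smul, ← ha]
    module
  rw [div_eq_inv_mul, ← smul_smul, ← h2, smul_smul]
  norm_num

/-- The square-root construction: an abelian superalgebra has an even automorphism relating any two
forms. -/
theorem IsInvariantPair.exists_isometry_of_bracket_eq_zero
    [FiniteDimensional ℂ E] [FiniteDimensional ℂ O]
    (hβ : IsInvariantPair ρ q β₀ β₁) (hγ : IsInvariantPair ρ q γ₀ γ₁) (hq0 : ∀ x y, q x y = 0) :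
    ∃ (φ₀ : E ≃ₗ[ℂ] E) (φ₁ : O ≃ₗ[ℂ] O), (∀ e x, φ₁ (ρ e x) = ρ (φ₀ e) (φ₁ x)) ∧
      (∀ x y, φ₀ (q x y) = q (φ₁ x) (φ₁ y)) ∧ (∀ e f, γ₀ (φ₀ e) (φ₀ f) = β₀ e f) ∧
      ∀ x y, γ₁ (φ₁ x) (φ₁ y) = β₁ x y := by
  obtain ⟨S, hS, hSa, -⟩ := β₀.exists_sqrt γ₀ hβ.nondeg_even hγ.nondeg_even 1 (by norm_num)
    (by simpa using hβ.symm_even) (by simpa using hγ.symm_even)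
  obtain ⟨T, hT, hTa, -⟩ := β₁.exists_sqrt γ₁ hβ.nondeg_odd hγ.nondeg_odd (-1) (by norm_num)
    (by simpa using hβ.skew_odd) (by simpa using hγ.skew_odd)
  have hρ : ∀ e x, ρ e x = 0 := fun e x => hβ.nondeg_odd _ fun y => by
    rw [hβ.invariant, hq0, map_zero]
  exact ⟨S.symm, T.symm, by simp [hρ], by simp [hq0], by simp [hS, hSa], by simp [hT, hTa]⟩

theorem IsInvariantPair.exists_isometry_of_bracket_ne_zero [FiniteDimensional ℂ O]
    (hE : Module.finrank ℂ E = 2) (hq : ∀ x y, q x y = q y x) (hJ : ∀ x, ρ (q x x) x = 0)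
    (hβ : IsInvariantPair ρ q β₀ β₁) (hγ : IsInvariantPair ρ q γ₀ γ₁)
    {x₀ : O} (hx₀ : q x₀ x₀ ≠ 0) :
    ∃ (φ₀ : E ≃ₗ[ℂ] E) (φ₁ : O ≃ₗ[ℂ] O), (∀ e x, φ₁ (ρ e x) = ρ (φ₀ e) (φ₁ x)) ∧
      (∀ x y, φ₀ (q x y) = q (φ₁ x) (φ₁ y)) ∧ (∀ e f, γ₀ (φ₀ e) (φ₀ f) = β₀ e f) ∧
      ∀ x y, γ₁ (φ₁ x) (φ₁ y) = β₁ x y := by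
  have : FiniteDimensional ℂ E := Module.finite_of_finrank_eq_succ hE
  have hspan := hβ.bracket_mem_span hE hq hJ hx₀
  have hβX := hβ.form_bracket_self_bracket hJ x₀ x₀
  have hγX := hγ.form_bracket_self_bracket hJ x₀ x₀
  generalize q x₀ x₀ = X at *
  obtain ⟨Y, hXY⟩ : ∃ Y, β₀ X Y = 1 := by
    by_contra! h
    refine hx₀ (hβ.nondeg_even X fun y => ?_)
    by_contra hy
    exact h ((β₀ X y)⁻¹ • y) (by simp [hy])
  have hYX : β₀ Y X = 1 := by rw [hβ.symm_even, hXY]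
  have hdec : ∀ e, ∃ a b : ℂ, e = a • Y + b • X := fun e => by
    obtain ⟨b, hb⟩ := β₀.mem_span_of_isotropic hE hβ.nondeg_even hx₀ hβX
      (v := e - β₀ X e • Y) (by simp [hXY])
    exact ⟨β₀ X e, b, by rw [← hb]; abel⟩
  have hρX : ∀ x, ρ X x = 0 := fun x => hβ.nondeg_odd _ fun y => by
    obtain ⟨c, hc⟩ := hspan x y
    rw [hβ.invariant, hc, map_smul, hβX, smul_zero]
  have hqY : ∀ x y, q x y = β₁ (ρ Y x) y • X := fun x y => by
    obtain ⟨c, hc⟩ := hspan x y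
    rw [hβ.invariant, hc]
    simp [hYX]
  set μ := γ₀ X Y with hμ
  have hγYX : γ₀ Y X = μ := hγ.symm_even _ _
  have hμ0 : μ ≠ 0 := fun h => hx₀ (hγ.nondeg_even X fun e => by
    obtain ⟨a, b, rfl⟩ := hdec e
    simp [hγX, ← hμ, h])
  obtain ⟨S, hS, hSa, hSC⟩ := β₁.exists_sqrt γ₁ hβ.nondeg_odd hγ.nondeg_odd (-1) (by norm_num)
    (by simpa using hβ.skew_odd) (by simpa using hγ.skew_odd)
  have hMC : ∀ x, S (S (ρ Y x)) = μ • ρ Y x := fun x => by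
    rw [← sub_eq_zero]
    refine hβ.nondeg_odd _ fun y => ?_
    rw [map_sub, LinearMap.sub_apply, ← hS, hγ.invariant, hqY]
    simp [hγYX, mul_comm]
  have hCs : ∀ x y, β₁ (ρ Y x) y = β₁ (ρ Y y) x := fun x y => by
    rw [hβ.invariant, hq, ← hβ.invariant]
  have hCM : ∀ x, ρ Y (S (S x)) = μ • ρ Y x := fun x => by
    rw [← sub_eq_zero]
    refine hβ.nondeg_odd _ fun y => ?_
    rw [map_sub, LinearMap.sub_apply, hCs, ← hSa, ← hSa, hMC, map_smul, map_smul,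
      LinearMap.smul_apply, LinearMap.smul_apply, hCs y x, sub_self]
  have hC := hSC (ρ Y) fun x => by rw [hCM, hMC]
  have hC' : ∀ x, ρ Y (S.symm x) = S.symm (ρ Y x) := fun x => by
    rw [LinearEquiv.eq_symm_apply, ← hC, LinearEquiv.apply_symm_apply]
  -- Solves `γ₀(Y + bX, Y + bX) = γ₀(Y, Y) + 2bμ = β₀(Y, Y)`.
  set b := (β₀ Y Y - γ₀ Y Y) / (2 * μ) with hb
  let φ : E →ₗ[ℂ] E := (β₀ X).smulRight (Y + b • X) +
    μ⁻¹ • (LinearMap.id - (β₀ X).smulRight Y)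
  have hφ : ∀ a c : ℂ, φ (a • Y + c • X) = a • Y + (a * b + μ⁻¹ * c) • X := fun a c => by
    simp only [φ, LinearMap.add_apply, LinearMap.smulRight_apply, LinearMap.smul_apply,
      LinearMap.sub_apply, LinearMap.id_apply, map_add, map_smul, hXY, hβX]
    module
  have hφX : φ X = μ⁻¹ • X := by simpa using hφ 0 1
  have hiso : ∀ e f, γ₀ (φ e) (φ f) = β₀ e f := fun e f => by
    obtain ⟨a, c, rfl⟩ := hdec e
    obtain ⟨a', c', rfl⟩ := hdec f
    rw [hφ, hφ]
    simp only [map_add, map_smul, LinearMap.add_apply, LinearMap.smul_apply, smul_eq_mul,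
      hγX, hβX, hXY, hYX, hγYX, ← hμ, hb]
    field_simp
    ring
  have hφi : Function.Injective φ := (injective_iff_map_eq_zero φ).2 fun e he =>
    hβ.nondeg_even e fun f => by rw [← hiso, he]; simp
  refine ⟨LinearEquiv.ofInjectiveEndo φ hφi, S.symm, fun e x => ?_, fun x y => ?_, ?_, ?_⟩
  · obtain ⟨a, c, rfl⟩ := hdec e
    simp [hφ, hρX, hC']
  · rw [hqY, hqY, hC']
    -- `S²` is the scalar `μ` on the image of `ρ Y`, so `S⁻²` produces the factor `μ⁻¹` by which `φ`
    -- scales `X`.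
    have h2 : S.symm (ρ Y x) = μ⁻¹ • S (ρ Y x) := by
      rw [LinearEquiv.symm_apply_eq, map_smul, hMC, inv_smul_smul₀ hμ0]
    have h3 : β₁ (S.symm (S.symm (ρ Y x))) y = μ⁻¹ * β₁ (ρ Y x) y := by
      rw [h2, map_smul, LinearEquiv.symm_apply_apply, map_smul, LinearMap.smul_apply, smul_eq_mul]
    have h4 : β₁ (S.symm (ρ Y x)) (S.symm y) = β₁ (S.symm (S.symm (ρ Y x))) y := by
      rw [← S.apply_symm_apply y, ← hSa]
      simp
    rw [h4, h3, LinearEquiv.coe_ofInjectiveEndo, map_smul, hφX, smul_smul, mul_comm]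
  · simpa using hiso
  · simp [hS, hSa]

/-- Any two invariant form pairs on the same data with two-dimensional even part are related by an
even automorphism. -/
theorem IsInvariantPair.exists_isometry [FiniteDimensional ℂ O]
    (hE : Module.finrank ℂ E = 2) (hq : ∀ x y, q x y = q y x) (hJ : ∀ x, ρ (q x x) x = 0)
    (hβ : IsInvariantPair ρ q β₀ β₁) (hγ : IsInvariantPair ρ q γ₀ γ₁) :
    ∃ (φ₀ : E ≃ₗ[ℂ] E) (φ₁ : O ≃ₗ[ℂ] O), (∀ e x, φ₁ (ρ e x) = ρ (φ₀ e) (φ₁ x)) ∧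
      (∀ x y, φ₀ (q x y) = q (φ₁ x) (φ₁ y)) ∧ (∀ e f, γ₀ (φ₀ e) (φ₀ f) = β₀ e f) ∧
      ∀ x y, γ₁ (φ₁ x) (φ₁ y) = β₁ x y := by
  have : FiniteDimensional ℂ E := Module.finite_of_finrank_eq_succ hE
  by_cases h : ∀ x, q x x = 0
  · refine hβ.exists_isometry_of_bracket_eq_zero hγ fun x y => ?_
    have h1 := h (x + y)
    simp only [map_add, LinearMap.add_apply, h, hq y x] at h1
    simpa [← two_smul ℂ] using h1
  · push Not at h
    obtain ⟨x₀, hx₀⟩ := h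
    exact IsInvariantPair.exists_isometry_of_bracket_ne_zero hE hq hJ hβ hγ hx₀

end

/-! ### Abelian even part and the graded components of a structure -/

/-- A two-dimensional Lie algebra with a nondegenerate invariant symmetric form is abelian. -/
theorem LinearMap.BilinForm.bracket_eq_zero_of_finrank_eq_two {E : Type*} [AddCommGroup E]
    [Module ℂ E] (hE : Module.finrank ℂ E = 2) (β : LinearMap.BilinForm ℂ E)
    (hβ : ∀ x, (∀ y, β x y = 0) → x = 0) (hs : ∀ x y, β x y = β y x)
    (r : E →ₗ[ℂ] E →ₗ[ℂ] E) (hr : ∀ x y, r x y = -r y x)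
    (hinv : ∀ x y z, β (r x y) z = β x (r y z)) (x y : E) : r x y = 0 := by
  have : FiniteDimensional ℂ E := Module.finite_of_finrank_eq_succ hE
  have : IsAddTorsionFree E := .of_isTorsionFree ℂ E
  have hself : ∀ x, r x x = 0 := fun x => self_eq_neg.1 (hr x x)
  by_cases hx : x = 0
  · simp [hx]
  by_cases hli : LinearIndependent ℂ ![x, y]
  · have hsp := hli.span_eq_top_of_card_eq_finrank (by simp [hE])
    refine hβ _ fun z => ?_
    have hz : z ∈ Submodule.span ℂ (Set.range ![x, y]) := hsp ▸ Submodule.mem_top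
    rw [Matrix.range_cons, Matrix.range_cons, Matrix.range_empty, Set.union_empty,
      Set.singleton_union, Submodule.mem_span_pair] at hz
    obtain ⟨a, b, rfl⟩ := hz
    have h1 : β (r x y) x = 0 := by
      rw [hs, ← hinv, hself, map_zero, LinearMap.zero_apply]
    have h2 : β (r x y) y = 0 := by rw [hinv, hself, map_zero]
    simp [h1, h2]
  · rw [LinearIndependent.pair_iff' hx] at hli
    push Not at hli
    obtain ⟨a, rfl⟩ := hli
    simp [hself]

section

variable {n : ℕ}

theorem inl_mem_stdGrading (e : Fin 2 → ℂ) :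
    ((e, 0) : (Fin 2 → ℂ) × (Fin (2 * n) → ℂ)) ∈ stdGrading n 0 := ⟨e, rfl⟩

theorem inr_mem_stdGrading (x : Fin (2 * n) → ℂ) :
    ((0, x) : (Fin 2 → ℂ) × (Fin (2 * n) → ℂ)) ∈ stdGrading n 1 := ⟨x, rfl⟩

theorem snd_eq_zero_of_mem_stdGrading {v : (Fin 2 → ℂ) × (Fin (2 * n) → ℂ)}
    (hv : v ∈ stdGrading n 0) : v.2 = 0 := by
  obtain ⟨e, rfl⟩ := hv
  rfl

theorem fst_eq_zero_of_mem_stdGrading {v : (Fin 2 → ℂ) × (Fin (2 * n) → ℂ)}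
    (hv : v ∈ stdGrading n 1) : v.1 = 0 := by
  obtain ⟨e, rfl⟩ := hv
  rfl

/-- The action of the even part on the odd part. -/
noncomputable def LieSuperalgebra.evenAction (g : LieSuperalgebra (stdGrading n)) :
    (Fin 2 → ℂ) →ₗ[ℂ] (Fin (2 * n) → ℂ) →ₗ[ℂ] (Fin (2 * n) → ℂ) :=
  (g.bracket.compl₁₂ (LinearMap.inl ℂ _ _) (LinearMap.inr ℂ _ _)).compr₂ (LinearMap.snd ℂ _ _)

/-- The bracket of two odd elements, as an element of the even part. -/
noncomputable def LieSuperalgebra.oddBracket (g : LieSuperalgebra (stdGrading n)) :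
    (Fin (2 * n) → ℂ) →ₗ[ℂ] (Fin (2 * n) → ℂ) →ₗ[ℂ] (Fin 2 → ℂ) :=
  (g.bracket.compl₁₂ (LinearMap.inr ℂ _ _) (LinearMap.inr ℂ _ _)).compr₂ (LinearMap.fst ℂ _ _)

/-- The bracket of the even part. -/
noncomputable def LieSuperalgebra.evenBracket (g : LieSuperalgebra (stdGrading n)) :
    (Fin 2 → ℂ) →ₗ[ℂ] (Fin 2 → ℂ) →ₗ[ℂ] (Fin 2 → ℂ) :=
  (g.bracket.compl₁₂ (LinearMap.inl ℂ _ _) (LinearMap.inl ℂ _ _)).compr₂ (LinearMap.fst ℂ _ _)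

/-- The form on the even part. -/
noncomputable def QuadraticLieSuperalgebra.evenForm (g : QuadraticStructures n) :
    LinearMap.BilinForm ℂ (Fin 2 → ℂ) :=
  g.form.compl₁₂ (LinearMap.inl ℂ _ _) (LinearMap.inl ℂ _ _)

/-- The form on the odd part. -/
noncomputable def QuadraticLieSuperalgebra.oddForm (g : QuadraticStructures n) :
    LinearMap.BilinForm ℂ (Fin (2 * n) → ℂ) :=
  g.form.compl₁₂ (LinearMap.inr ℂ _ _) (LinearMap.inr ℂ _ _)

theorem LieSuperalgebra.bracket_inl_inr (g : LieSuperalgebra (stdGrading n)) (e x) :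
    g.bracket (e, 0) (0, x) = (0, g.evenAction e x) :=
  Prod.ext (fst_eq_zero_of_mem_stdGrading
    (g.bracket_mem 0 1 _ (inl_mem_stdGrading e) _ (inr_mem_stdGrading x))) rfl

theorem LieSuperalgebra.bracket_inr_inl (g : LieSuperalgebra (stdGrading n)) (e x) :
    g.bracket (0, x) (e, 0) = (0, -g.evenAction e x) := by
  rw [g.bracket_skew 1 0 _ (inr_mem_stdGrading x) _ (inl_mem_stdGrading e), g.bracket_inl_inr]
  simp

theorem LieSuperalgebra.bracket_inr_inr (g : LieSuperalgebra (stdGrading n)) (x y) :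
    g.bracket (0, x) (0, y) = (g.oddBracket x y, 0) :=
  Prod.ext rfl (snd_eq_zero_of_mem_stdGrading
    (g.bracket_mem 1 1 _ (inr_mem_stdGrading x) _ (inr_mem_stdGrading y)))

theorem LieSuperalgebra.bracket_inl_inl (g : LieSuperalgebra (stdGrading n)) (e f) :
    g.bracket (e, 0) (f, 0) = (g.evenBracket e f, 0) :=
  Prod.ext rfl (snd_eq_zero_of_mem_stdGrading
    (g.bracket_mem 0 0 _ (inl_mem_stdGrading e) _ (inl_mem_stdGrading f)))

theorem LieSuperalgebra.oddBracket_comm (g : LieSuperalgebra (stdGrading n)) (x y) :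
    g.oddBracket x y = g.oddBracket y x := by
  have h := g.bracket_skew 1 1 _ (inr_mem_stdGrading x) _ (inr_mem_stdGrading y)
  rw [g.bracket_inr_inr, g.bracket_inr_inr] at h
  simpa [ZMod.val_one] using h

theorem LieSuperalgebra.evenBracket_skew (g : LieSuperalgebra (stdGrading n)) (x y) :
    g.evenBracket x y = -g.evenBracket y x := by
  have h := g.bracket_skew 0 0 _ (inl_mem_stdGrading x) _ (inl_mem_stdGrading y)
  rw [g.bracket_inl_inl, g.bracket_inl_inl] at h
  simpa using h

/-- The Jacobi identity at three equal odd elements gives three times this term equal to zero. -/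
theorem LieSuperalgebra.evenAction_oddBracket_self (g : LieSuperalgebra (stdGrading n)) (x) :
    g.evenAction (g.oddBracket x x) x = 0 := by
  have h := g.jacobi 1 1 1 _ (inr_mem_stdGrading x) _ (inr_mem_stdGrading x) _
    (inr_mem_stdGrading x)
  rw [g.bracket_inr_inr, g.bracket_inr_inl, g.bracket_inl_inr] at h
  have h2 := congrArg Prod.snd h
  simp [ZMod.val_one] at h2
  have h3 : (3 : ℂ) • g.evenAction (g.oddBracket x x) x = 0 := by
    have h4 : (3 : ℂ) • g.evenAction (g.oddBracket x x) x =
        (g.evenAction (g.oddBracket x x) x + g.evenAction (g.oddBracket x x) x) -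
          -g.evenAction (g.oddBracket x x) x := by module
    rw [h4, ← h2, sub_self]
  simpa using h3

theorem Prod.eq_inl_add_inr {E O : Type*} [AddCommGroup E] [AddCommGroup O] (v : E × O) :
    v = (v.1, 0) + (0, v.2) := by simp

theorem QuadraticLieSuperalgebra.form_apply (g : QuadraticStructures n) (v w) :
    g.form v w = g.evenForm v.1 w.1 + g.oddForm v.2 w.2 := by
  rw [v.eq_inl_add_inr, w.eq_inl_add_inr]
  simp only [map_add, LinearMap.add_apply]
  rw [g.form_even 0 1 (by decide) _ (inl_mem_stdGrading _) _ (inr_mem_stdGrading _),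
    g.form_even 1 0 (by decide) _ (inr_mem_stdGrading _) _ (inl_mem_stdGrading _)]
  simp [evenForm, oddForm]

theorem QuadraticLieSuperalgebra.isInvariantPair (g : QuadraticStructures n) :
    IsInvariantPair g.evenAction g.oddBracket g.evenForm g.oddForm where
  nondeg_even e he := by
    have h : ((e, 0) : (Fin 2 → ℂ) × (Fin (2 * n) → ℂ)) = 0 :=
      g.form_nondegenerate.1 _ fun w => by rw [g.form_apply]; simp [he]
    exact congrArg Prod.fst h
  nondeg_odd x hx := by
    have h : ((0, x) : (Fin 2 → ℂ) × (Fin (2 * n) → ℂ)) = 0 :=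
      g.form_nondegenerate.1 _ fun w => by rw [g.form_apply]; simp [hx]
    exact congrArg Prod.snd h
  symm_even x y := by
    simpa [g.form_apply] using
      g.form_supersymm 0 0 _ (inl_mem_stdGrading x) _ (inl_mem_stdGrading y)
  skew_odd x y := by
    simpa [g.form_apply, ZMod.val_one] using
      g.form_supersymm 1 1 _ (inr_mem_stdGrading x) _ (inr_mem_stdGrading y)
  invariant e x y := by
    have h := g.form_invariant (e, 0) (0, x) (0, y)
    rw [g.bracket_inl_inr, g.bracket_inr_inr] at h
    simpa [g.form_apply] using h

theorem QuadraticLieSuperalgebra.evenBracket_eq_zero (g : QuadraticStructures n) (e f) :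
    g.evenBracket e f = 0 := by
  have hg := g.isInvariantPair
  refine g.evenForm.bracket_eq_zero_of_finrank_eq_two (by simp) hg.nondeg_even hg.symm_even
    g.evenBracket g.evenBracket_skew (fun x y z => ?_) e f
  have h := g.form_invariant (x, 0) (y, 0) (z, 0)
  rw [g.bracket_inl_inl, g.bracket_inl_inl] at h
  simpa [g.form_apply] using h

theorem QuadraticLieSuperalgebra.bracket_apply (g : QuadraticStructures n) (v w) :
    g.bracket v w =
      (g.oddBracket v.2 w.2, g.evenAction v.1 w.2 - g.evenAction w.1 v.2) := by
  rw [v.eq_inl_add_inr, w.eq_inl_add_inr]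
  simp only [map_add, LinearMap.add_apply, g.bracket_inl_inl, g.bracket_inl_inr,
    g.bracket_inr_inl, g.bracket_inr_inr, g.evenBracket_eq_zero]
  simp [sub_eq_neg_add]

/-- The quadratic structure on the source of an isomorphism obtained by pulling the form back. -/
def QuadraticLieSuperalgebra.pullback (g g' : QuadraticStructures n)
    (A : LieSuperalgebra.Iso g.toLieSuperalgebra g'.toLieSuperalgebra) :
    QuadraticStructures n where
  toLieSuperalgebra := g.toLieSuperalgebra
  form := g'.form.compl₁₂ A.toLinearEquiv.toLinearMap A.toLinearEquiv.toLinearMap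
  form_nondegenerate := by
    refine ⟨fun x hx => ?_, fun x hx => ?_⟩
    · refine A.toLinearEquiv.map_eq_zero_iff.1 (g'.form_nondegenerate.1 _ fun y => ?_)
      simpa using hx (A.toLinearEquiv.symm y)
    · refine A.toLinearEquiv.map_eq_zero_iff.1 (g'.form_nondegenerate.2 _ fun y => ?_)
      simpa using hx (A.toLinearEquiv.symm y)
  form_even i j hij x hx y hy :=
    g'.form_even i j hij _ (A.map_mem i x hx) _ (A.map_mem j y hy)
  form_supersymm i j x hx y hy :=
    g'.form_supersymm i j _ (A.map_mem i x hx) _ (A.map_mem j y hy)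
  form_invariant x y z := by
    simp [A.map_bracket, g'.form_invariant]

/-- With the even bracket zero, the action and the odd bracket are the whole superbracket, so
compatible maps on the two parts assemble to an automorphism. -/
theorem QuadraticLieSuperalgebra.exists_automorphism (g : QuadraticStructures n)
    (h : QuadraticStructures n) (hgh : h.toLieSuperalgebra = g.toLieSuperalgebra) :
    ∃ φ : LieSuperalgebra.Iso g.toLieSuperalgebra g.toLieSuperalgebra,
      ∀ x y, h.form (φ.toLinearEquiv x) (φ.toLinearEquiv y) = g.form x y := by
  have hh := h.isInvariantPair
  rw [hgh] at hh
  obtain ⟨φ₀, φ₁, hρ, hq, h₀, h₁⟩ := IsInvariantPair.exists_isometry (by simp)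
    g.oddBracket_comm g.evenAction_oddBracket_self g.isInvariantPair hh
  refine ⟨{ toLinearEquiv := φ₀.prodCongr φ₁, map_mem := fun i x hx => ?_,
            map_bracket := fun x y => ?_ }, fun x y => ?_⟩
  · fin_cases i
    · obtain ⟨e, rfl⟩ := hx
      exact ⟨φ₀ e, by simp⟩
    · obtain ⟨e, rfl⟩ := hx
      exact ⟨φ₁ e, by simp⟩
  · simp [g.bracket_apply, hq, hρ]
  · simp [g.form_apply, h.form_apply, h₀, h₁]

end

theorem proposition3p4p13 (n : ℕ) (g g' : QuadraticStructures n) :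
    g.IsIsometricallyIsomorphic g' ↔ g.IsIsomorphic g' := by
  refine ⟨fun ⟨A, _⟩ => ⟨A⟩, fun ⟨A⟩ => ?_⟩
  obtain ⟨φ, hφ⟩ := g.exists_automorphism (g.pullback g' A) rfl
  exact ⟨{ toLinearEquiv := φ.toLinearEquiv.trans A.toLinearEquiv
           map_mem := fun i x hx => A.map_mem i _ (φ.map_mem i x hx)
           map_bracket := fun x y => by simp [φ.map_bracket, A.map_bracket] }, hφ⟩
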